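/- Fix $r>0$ and $n\ge 0$. Let $C=C([-r,0],\mathbb R^n)$ with the supremum norm ($\mathbb R^n$ Euclidean), and let $W^{1,\infty}\subset C$ be the space of Lipschitz functions $\psi\colon[-r,0]\to\mathbb R^n$ with the norm $\max\{\|\psi\|_C,\|\dot\psi\|_{L^\infty}\}$. For $y$ continuous on $[t-r,t]$ write $y_t\in C$, $y_t(s)=y(t+s)$. Let $(t,\omega)\mapsto\omega\cdot t$ be a continuous flow on a compact metric space $\Omega$, and let $F\colon\Omega\times\mathbb R^n\times\mathbb R^n\to\mathbb R^n$ and $\tau\colon\Omega\times C\to[0,r]$ satisfy: (H1) $F$ is continuous and its partial derivatives $D_2F$, $D_3F$ with respect to the second and third arguments exist and are continuous on $\Omega\times\mathbb R^n\times\mathbb R^n$; (H2) $\tau$ is continuous and differentiable with respect to its second argument, with $D_2\tau\colon\Omega\times C\to\mathcal L(C,\mathbb R)$ continuous. For $(\omega,x)\in\Omega\times W^{1,\infty}$ let $y(\cdot,\omega,x)$, defined on $[-r,\beta_{\omega,x})$, be the maximal solution of $$\dot y(t)=F\big(\omega\cdot t,\,y(t),\,y(t-\tau(\omega\cdot t,y_t))\big),\quad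 t\ge 0,\qquad y_0=x$$ (right derivative at $t=0$), and put $u(t,\omega,x)=y(\cdot,\omega,x)_t\in W^{1,\infty}$ and $\Pi(t,\omega,x)=(\omega\cdot t,u(t,\omega,x))$ for $0\le t<\beta_{\omega,x}$. Let $\mathcal K\subset\Omega\times W^{1,\infty}$ be a compact set that is positively $\Pi$-invariant (for every $p=(\omega,x)\in\mathcal K$, $\beta_{\omega,x}=\infty$ and $\Pi(t,p)\in\mathcal K$ for all $t\ge0$), and suppose that every $p\in\mathcal K$ admits a backward extension in $\mathcal K$: a continuous $\theta\colon(-\infty,0]\to\mathcal K$ with $\theta(0)=p$ and $\Pi(t,\theta(s))=\theta(t+s)$ whenever $s\le -t\le 0$. (Then $x$ is of class $C^1$ for every $(\omega,x)\in\mathcal K$.) For $(\omega,x)\in\mathcal K$ and $\phi\in C$ put, with $\tau=\tau(\omega,x)$ and all derivatives of $F$ evaluated at $(\omega,x(0),x(-\tau))$, $$L(\omega,x)\phi=D_2F\,\phi(0)+D_3F\,\phi(-\tau)-\big(D_2\tau(\omega,x)\phi\big)\,D_3F\,\dot x(-\tau).$$ Let $(\omega,\bar x)\in\mathcal K$ and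 $T\ge r$. Then for every $v\in C$ the variational equation $$\dot z(t)=L(\Pi(t,\omega,\bar x))\,z_t,\quad t\ge 0,\qquad z_0=v,$$ has exactly one solution $z(\cdot,\omega,\bar x,v)$ on $[-r,\infty)$, and: 1. the function $z_T(\cdot,\omega,\bar x,v)$ belongs to $W^{1,\infty}$ for every $v\in C$, and the linear map $\widehat\pi_L(T,\omega,\bar x)\colon C\to W^{1,\infty}$, $v\mapsto z_T(\cdot,\omega,\bar x,v)$, is continuous; 2. if $T\ge 2r$, then $\widehat\pi_L(T,\omega,\bar x)\colon C\to W^{1,\infty}$ is compact; 3. if $T\ge 2r$, then the linear operator $\pi_L(T,\omega,\bar x)\colon W^{1,\infty}\to W^{1,\infty}$, $v\mapsto z_T(\cdot,\omega,\bar x,v)$, is compact. -/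

import Mathlib

open Set Topology MeasureTheory
open scoped NNReal ENNReal

noncomputable section

/-- The space `C = C([-r,0], ℝⁿ)` with the supremum norm (`ℝⁿ` Euclidean). -/
abbrev HistC (n : ℕ) (r : ℝ) : Type :=
  C(Set.Icc (-r) (0 : ℝ), EuclideanSpace ℝ (Fin n))

namespace HistC

variable {n : ℕ} {r : ℝ}

/-- A function on `[-r,0]` as a function on `ℝ` (its values outside `[-r,0]` are irrelevant). -/
def ext (f : HistC n r) (s : ℝ) : EuclideanSpace ℝ (Fin n) :=
  open Classical in if h : s ∈ Set.Icc (-r) 0 then f ⟨s, h⟩ else 0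

/-- The derivative of `f` on `[-r,0]` (one-sided at the end points). -/
def derivative (f : HistC n r) : ℝ → EuclideanSpace ℝ (Fin n) :=
  derivWithin f.ext (Set.Icc (-r) 0)

/-- The essential supremum of `|f'|` on `[-r,0]` with respect to Lebesgue measure. -/
def derivSup (f : HistC n r) : ℝ≥0∞ :=
  eLpNorm f.derivative ∞ (volume.restrict (Set.Icc (-r) 0))

/-- `f` is Lipschitz continuous on `[-r,0]`. -/
def IsLip (f : HistC n r) : Prop := ∃ k : ℝ≥0, LipschitzWith k f

theorem ext_add (f g : HistC n r) : (f + g).ext = f.ext + g.ext := by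
  funext s
  by_cases h : s ∈ Set.Icc (-r) 0 <;> simp [ext, h]

theorem ext_smul (c : ℝ) (f : HistC n r) : (c • f).ext = c • f.ext := by
  funext s
  by_cases h : s ∈ Set.Icc (-r) 0 <;> simp [ext, h]

theorem lipschitzOnWith_ext {f : HistC n r} {k : ℝ≥0} (hf : LipschitzWith k f) :
    LipschitzOnWith k f.ext (Set.Icc (-r) 0) := by
  intro x hx y hy
  simpa [ext, hx, hy] using hf ⟨x, hx⟩ ⟨y, hy⟩

theorem ae_differentiable {f : HistC n r} (hf : f.IsLip) :
    ∀ᵐ x ∂(volume.restrict (Set.Icc (-r) 0)),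
      DifferentiableWithinAt ℝ f.ext (Set.Icc (-r) 0) x := by
  obtain ⟨k, hk⟩ := hf
  exact (lipschitzOnWith_ext hk).ae_differentiableWithinAt_real measurableSet_Icc

theorem derivSup_add_le {f g : HistC n r} (hf : f.IsLip) (hg : g.IsLip) :
    (f + g).derivSup ≤ f.derivSup + g.derivSup := by
  have h : (f + g).derivative =ᵐ[volume.restrict (Set.Icc (-r) 0)]
      f.derivative + g.derivative := by
    filter_upwards [ae_differentiable hf, ae_differentiable hg] with x h1 h2
    simp only [derivative, ext_add, Pi.add_apply]
    exact derivWithin_add h1 h2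
  unfold derivSup
  rw [eLpNorm_congr_ae h]
  simp only [eLpNorm_exponent_top]
  exact eLpNormEssSup_add_le

theorem derivSup_smul {f : HistC n r} (hf : f.IsLip) (c : ℝ) :
    (c • f).derivSup = ‖c‖ₑ * f.derivSup := by
  have h : (c • f).derivative =ᵐ[volume.restrict (Set.Icc (-r) 0)] c • f.derivative := by
    filter_upwards [ae_differentiable hf] with x h1
    simp only [derivative, ext_smul, Pi.smul_apply]
    exact derivWithin_const_smul c h1
  unfold derivSup
  rw [eLpNorm_congr_ae h, eLpNorm_const_smul]

theorem derivSup_ne_top {f : HistC n r} (hf : f.IsLip) : f.derivSup ≠ ∞ := by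
  obtain ⟨k, hk⟩ := hf
  have h : ∀ᵐ x ∂(volume.restrict (Set.Icc (-r) 0)), ‖f.derivative x‖ ≤ k := by
    rw [← Measure.restrict_congr_set Ioo_ae_eq_Icc, ae_restrict_iff' measurableSet_Ioo]
    refine Filter.Eventually.of_forall fun x hx => ?_
    have hn : Set.Icc (-r) 0 ∈ 𝓝 x := Icc_mem_nhds hx.1 hx.2
    rw [derivative, derivWithin_of_mem_nhds hn]
    exact norm_deriv_le_of_lipschitzOn hn (lipschitzOnWith_ext hk)
  unfold derivSup
  rw [eLpNorm_exponent_top]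
  exact ((eLpNormEssSup_le_of_ae_bound h).trans_lt ENNReal.ofReal_lt_top).ne

theorem isLip_add {f g : HistC n r} (hf : f.IsLip) (hg : g.IsLip) : (f + g).IsLip := by
  obtain ⟨k, hk⟩ := hf
  obtain ⟨l, hl⟩ := hg
  exact ⟨k + l, hk.add hl⟩

theorem isLip_zero : (0 : HistC n r).IsLip := ⟨0, LipschitzWith.const 0⟩

theorem isLip_smul (c : ℝ) {f : HistC n r} (hf : f.IsLip) : (c • f).IsLip := by
  obtain ⟨k, hk⟩ := hf
  refine ⟨‖c‖₊ * k, fun x y => ?_⟩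
  have h := hk x y
  simp only [ContinuousMap.coe_smul, Pi.smul_apply, edist_smul₀, ENNReal.smul_def, smul_eq_mul,
    ENNReal.coe_mul, mul_assoc]
  gcongr

end HistC

/-- The Lipschitz functions as a linear subspace of `C`. -/
def lipSubmodule (n : ℕ) (r : ℝ) : Submodule ℝ (HistC n r) where
  carrier := {f | f.IsLip}
  add_mem' := HistC.isLip_add
  zero_mem' := HistC.isLip_zero
  smul_mem' := fun c _ hf => HistC.isLip_smul c hf

/-- The space `W^{1,∞}` of Lipschitz functions `[-r,0] → ℝⁿ`. It is a separate type, so that it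
carries the norm below and not the supremum norm. -/
def LipW (n : ℕ) (r : ℝ) : Type := lipSubmodule n r

namespace LipW

variable {n : ℕ} {r : ℝ}

instance : AddCommGroup (LipW n r) := inferInstanceAs (AddCommGroup (lipSubmodule n r))

instance : Module ℝ (LipW n r) := inferInstanceAs (Module ℝ (lipSubmodule n r))

/-- The (linear) inclusion `W^{1,∞} → C`. -/
def toC : LipW n r →ₗ[ℝ] HistC n r := (lipSubmodule n r).subtype

theorem isLip (f : LipW n r) : f.toC.IsLip := f.2

theorem toC_injective : Function.Injective (toC : LipW n r → HistC n r) :=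
  Subtype.val_injective

/-- The norm `‖f‖ = max {‖f‖_C, ‖f'‖_{L^∞}}`. -/
instance : Norm (LipW n r) := ⟨fun f => max ‖f.toC‖ f.toC.derivSup.toReal⟩

theorem norm_def (f : LipW n r) : ‖f‖ = max ‖f.toC‖ f.toC.derivSup.toReal := rfl

theorem normCore : NormedSpace.Core ℝ (LipW n r) where
  norm_nonneg f := le_max_of_le_left (norm_nonneg f.toC)
  norm_smul c f := by
    simp only [norm_def, map_smul]
    rw [HistC.derivSup_smul f.isLip, norm_smul, ENNReal.toReal_mul, toReal_enorm,
      mul_max_of_nonneg _ _ (norm_nonneg c)]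
  norm_triangle f g := by
    simp only [norm_def, map_add]
    refine max_le ((norm_add_le _ _).trans (add_le_add (le_max_left _ _) (le_max_left _ _))) ?_
    have h := ENNReal.toReal_mono
      (ENNReal.add_ne_top.2 ⟨HistC.derivSup_ne_top f.isLip, HistC.derivSup_ne_top g.isLip⟩)
      (HistC.derivSup_add_le f.isLip g.isLip)
    rw [ENNReal.toReal_add (HistC.derivSup_ne_top f.isLip) (HistC.derivSup_ne_top g.isLip)] at h
    exact h.trans (add_le_add (le_max_right _ _) (le_max_right _ _))
  norm_eq_zero_iff f := by
    constructor
    · intro h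
      have h1 : ‖f.toC‖ ≤ 0 := (le_max_left _ _).trans h.le
      exact toC_injective (by rw [map_zero]; exact norm_le_zero_iff.1 h1)
    · rintro rfl
      have h := HistC.derivSup_smul (HistC.isLip_zero (n := n) (r := r)) (0 : ℝ)
      have h0 : (0 : ℝ) • (0 : HistC n r) = 0 := by ext; simp
      rw [h0, enorm_zero, zero_mul] at h
      simp [norm_def, h]

instance : NormedAddCommGroup (LipW n r) := NormedAddCommGroup.ofCore normCore

instance : NormedSpace ℝ (LipW n r) := NormedSpace.ofCore normCore

/-- An element of `C` that is Lipschitz, regarded as an element of `W^{1,∞}`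
(and the default value `0` if it is not Lipschitz). -/
def ofC (f : HistC n r) : LipW n r :=
  open Classical in if h : f ∈ lipSubmodule n r then ⟨f, h⟩ else 0

end LipW

/-- The segment `y_t ∈ C`, `y_t(s) = y(t+s)` for `s ∈ [-r,0]`, of a function `y` that is continuous
on `[t-r,t]` (and the default value `0` if `y` is not continuous there). -/
def histSegment {n : ℕ} (r : ℝ) (y : ℝ → EuclideanSpace ℝ (Fin n)) (t : ℝ) : HistC n r :=
  open Classical in
  if h : Continuous fun s : Set.Icc (-r) (0 : ℝ) => y (t + s) then ⟨_, h⟩ else 0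

/-- The data of the family of state-dependent delay equations
`y'(t) = F(ω·t, y(t), y(t - τ(ω·t, y_t)))`, `ω ∈ Ω`: a continuous flow on `Ω`, the vector field `F`
and the delay `τ : Ω × C → [0,r]`. -/
structure DelaySystem (Ω : Type*) [TopologicalSpace Ω] (n : ℕ) (r : ℝ) where
  σ : Flow ℝ Ω
  F : Ω → EuclideanSpace ℝ (Fin n) → EuclideanSpace ℝ (Fin n) → EuclideanSpace ℝ (Fin n)
  τ : Ω → HistC n r → ℝ
  τ_mem : ∀ ω x, τ ω x ∈ Set.Icc 0 r

namespace DelaySystem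

variable {Ω : Type*} [TopologicalSpace Ω] {n : ℕ} {r : ℝ} (S : DelaySystem Ω n r)

/-- The partial derivative `D₂F`. -/
def D₂F (ω : Ω) (a b : EuclideanSpace ℝ (Fin n)) :
    EuclideanSpace ℝ (Fin n) →L[ℝ] EuclideanSpace ℝ (Fin n) :=
  fderiv ℝ (fun a' => S.F ω a' b) a

/-- The partial derivative `D₃F`. -/
def D₃F (ω : Ω) (a b : EuclideanSpace ℝ (Fin n)) :
    EuclideanSpace ℝ (Fin n) →L[ℝ] EuclideanSpace ℝ (Fin n) :=
  fderiv ℝ (fun b' => S.F ω a b') b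

/-- The partial derivative `D₂τ`. -/
def D₂τ (ω : Ω) (x : HistC n r) : HistC n r →L[ℝ] ℝ :=
  fderiv ℝ (S.τ ω) x

/-- Regularity of the vector field: `F` is continuous, and its partial derivatives with respect to
the second and third arguments exist and are continuous. -/
structure FieldRegular : Prop where
  cont : Continuous fun p : Ω × EuclideanSpace ℝ (Fin n) × EuclideanSpace ℝ (Fin n) =>
    S.F p.1 p.2.1 p.2.2
  diff₂ : ∀ ω a b, DifferentiableAt ℝ (fun a' => S.F ω a' b) a
  diff₃ : ∀ ω a b, DifferentiableAt ℝ (fun b' => S.F ω a b') b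
  cont₂ : Continuous fun p : Ω × EuclideanSpace ℝ (Fin n) × EuclideanSpace ℝ (Fin n) =>
    S.D₂F p.1 p.2.1 p.2.2
  cont₃ : Continuous fun p : Ω × EuclideanSpace ℝ (Fin n) × EuclideanSpace ℝ (Fin n) =>
    S.D₃F p.1 p.2.1 p.2.2

/-- Regularity of the delay: `τ` is continuous and differentiable with respect to its second
argument, with `D₂τ : Ω × C → L(C, ℝ)` continuous. -/
structure DelayRegular : Prop where
  cont : Continuous fun p : Ω × HistC n r => S.τ p.1 p.2
  diff : ∀ ω x, DifferentiableAt ℝ (S.τ ω) x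
  cont_deriv : Continuous fun p : Ω × HistC n r => S.D₂τ p.1 p.2

/-- `y` is a solution on `[-r,b)` of the delay equation given by `ω` with initial datum `x`.
The derivative at `t = 0` is the right one, and at `t > 0` it is two-sided. -/
structure IsSolution (ω : Ω) (x : HistC n r) (b : EReal) (y : ℝ → EuclideanSpace ℝ (Fin n)) :
    Prop where
  init : ∀ s : Set.Icc (-r) (0 : ℝ), y s = x s
  cont : ContinuousOn y {t : ℝ | -r ≤ t ∧ (t : EReal) < b}
  deriv : ∀ t : ℝ, 0 ≤ t → (t : EReal) < b →
    HasDerivWithinAt y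
      (S.F (S.σ t ω) (y t) (y (t - S.τ (S.σ t ω) (histSegment r y t)))) (Set.Ici 0) t

/-- `y` is a maximal (that is, nonextendable) solution on `[-r,b)`, where `0 < b ≤ ∞`. -/
structure IsMaximalSolution (ω : Ω) (x : HistC n r) (b : EReal)
    (y : ℝ → EuclideanSpace ℝ (Fin n)) : Prop where
  pos : 0 < b
  sol : S.IsSolution ω x b y
  max : ∀ (b' : EReal) (y' : ℝ → EuclideanSpace ℝ (Fin n)), b ≤ b' → S.IsSolution ω x b' y' →
    Set.EqOn y y' {t : ℝ | -r ≤ t ∧ (t : EReal) < b} → b' = b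

/-- The pair `(β_{ω,x}, y(·,ω,x))` formed by the maximal solution with datum `(ω,x)` and the right
end of its interval of definition (if no maximal solution existed, this would be `(0, 0)`). -/
def maximal (ω : Ω) (x : LipW n r) : EReal × (ℝ → EuclideanSpace ℝ (Fin n)) :=
  open Classical in
  if h : ∃ q : EReal × (ℝ → EuclideanSpace ℝ (Fin n)), S.IsMaximalSolution ω x.toC q.1 q.2
  then h.choose else (0, fun _ => 0)

/-- `β_{ω,x}`. -/
def lifetime (p : Ω × LipW n r) : EReal := (S.maximal p.1 p.2).1

/-- `u(t,ω,x) ∈ W^{1,∞}`, `u(t,ω,x)(s) = y(t+s,ω,x)`, for `0 ≤ t < β_{ω,x}`. -/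
def u (t : ℝ) (p : Ω × LipW n r) : LipW n r :=
  LipW.ofC (histSegment r (S.maximal p.1 p.2).2 t)

/-- The local semiflow `Π(t,ω,x) = (ω·t, u(t,ω,x))`, meaningful for `0 ≤ t < β_{ω,x}`. -/
def semiflow (t : ℝ) (p : Ω × LipW n r) : Ω × LipW n r := (S.σ t p.1, S.u t p)

/-- `K` is positively `Π`-invariant; in particular `β_{ω,x} = ∞` for `(ω,x) ∈ K`. -/
def PositivelyInvariant (K : Set (Ω × LipW n r)) : Prop :=
  ∀ p ∈ K, S.lifetime p = ⊤ ∧ ∀ t : ℝ, 0 ≤ t → S.semiflow t p ∈ K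

/-- `p` admits a backward extension in `K`: there is a continuous `θ : (-∞,0] → K` with `θ(0) = p`
and `Π(t, θ(s)) = θ(t+s)` whenever `s ≤ -t ≤ 0`. -/
def HasBackwardExtension (K : Set (Ω × LipW n r)) (p : Ω × LipW n r) : Prop :=
  ∃ θ : ℝ → Ω × LipW n r, ContinuousOn θ (Set.Iic 0) ∧ (∀ s ≤ 0, θ s ∈ K) ∧ θ 0 = p ∧
    ∀ s t : ℝ, s ≤ -t → -t ≤ 0 → S.semiflow t (θ s) = θ (t + s)

theorem zero_mem (S : DelaySystem Ω n r) (ω : Ω) (x : HistC n r) : (0 : ℝ) ∈ Set.Icc (-r) (0 : ℝ) :=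
  ⟨by linarith [(S.τ_mem ω x).1, (S.τ_mem ω x).2], le_rfl⟩

theorem neg_τ_mem (S : DelaySystem Ω n r) (ω : Ω) (x : HistC n r) : -S.τ ω x ∈ Set.Icc (-r) (0 : ℝ) :=
  ⟨by linarith [(S.τ_mem ω x).2], by linarith [(S.τ_mem ω x).1]⟩

/-- The operator `L(ω,x) φ = D₂F(ω,x(0),x(-τ)) φ(0) + D₃F(ω,x(0),x(-τ)) φ(-τ)
- (D₂τ(ω,x) φ) D₃F(ω,x(0),x(-τ)) x'(-τ)`, with `τ = τ(ω,x)`, as a bounded operator on `C`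
(and hence, by restriction, on `W^{1,∞}`). -/
def L (p : Ω × LipW n r) : HistC n r →L[ℝ] EuclideanSpace ℝ (Fin n) :=
  let ω := p.1
  let x := p.2.toC
  let zr : Set.Icc (-r) (0 : ℝ) := ⟨0, S.zero_mem ω x⟩
  let dl : Set.Icc (-r) (0 : ℝ) := ⟨-S.τ ω x, S.neg_τ_mem ω x⟩
  (S.D₂F ω (x zr) (x dl)).comp (ContinuousMap.evalCLM ℝ zr)
    + (S.D₃F ω (x zr) (x dl)).comp (ContinuousMap.evalCLM ℝ dl)
    - (S.D₂τ ω x).smulRight (S.D₃F ω (x zr) (x dl) (x.derivative (-S.τ ω x)))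

/-- `z : [-r,∞) → ℝⁿ` is the solution of the variational equation `z'(t) = L(Π(t,p)) z_t`, `t ≥ 0`,
with initial datum `v` (the derivative at `0` is the right one). Only the values of `z` on
`[-r,∞)` matter. -/
structure IsVariationalSolution (p : Ω × LipW n r) (v : HistC n r)
    (z : ℝ → EuclideanSpace ℝ (Fin n)) : Prop where
  init : ∀ s : Set.Icc (-r) (0 : ℝ), z s = v s
  cont : ContinuousOn z (Set.Ici (-r))
  deriv : ∀ t : ℝ, 0 ≤ t →
    HasDerivWithinAt z (S.L (S.semiflow t p) (histSegment r z t)) (Set.Ici 0) t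

/-- The solution `z(·,p,v)` of the variational equation (`0` if there were none). -/
def varSol (p : Ω × LipW n r) (v : HistC n r) : ℝ → EuclideanSpace ℝ (Fin n) :=
  open Classical in
  if h : ∃ z, S.IsVariationalSolution p v z then h.choose else fun _ => 0

/-- The linearized solution operator on `C`: `v ↦ z_t(·,p,v)`. -/
def piTilde (t : ℝ) (p : Ω × LipW n r) (v : HistC n r) : HistC n r :=
  histSegment r (S.varSol p v) t

/-- The linearized solution operator from `C` to `W^{1,∞}`. -/
def piHat (t : ℝ) (p : Ω × LipW n r) (v : HistC n r) : LipW n r :=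
  LipW.ofC (S.piTilde t p v)

/-- The linearized solution operator on `W^{1,∞}`: `v ↦ z_t(·,p,v)`. -/
def piL (t : ℝ) (p : Ω × LipW n r) (v : LipW n r) : LipW n r :=
  LipW.ofC (histSegment r (S.varSol p v.toC) t)

end DelaySystem

end

/-! ### Segments -/

section Segments

variable {n : ℕ} {r : ℝ}

/-! Along the trajectory of a point of `K` the variational equation is a linear delay equation z'(t)
= A(t) z_t. The backward extension makes the initial function a segment of an earlier solution, so
the trajectory y is C¹ on [-r,∞), including the junction t = 0 (`exists_trajectory`). The term ẋ(-τ)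
then becomes y'(t - τ), and t ↦ A(t)φ is continuous for each fixed φ (`continuous_L_semiflow`).
Evaluation at a moving point -τ need not be continuous in operator norm, so only this strong
continuity is used; Banach–Steinhaus supplies bounds for ‖A(t)‖ on compact intervals.

In a norm with weight exp(-ct), c large, the integral operator halves distances. This gives
existence by contraction, and an a priori bound by ‖v‖, hence uniqueness. For T ≥ r the window
[T-r,T] lies in t ≥ 0, where z' = A(t) z_t is bounded by a multiple of ‖v‖; so C → W^{1,∞} is
bounded (`exists_solutionOperator`).

For T ≥ 2r the map factors through time T - r ≥ r: the unit ball goes into a set of uniformly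
bounded, uniformly Lipschitz functions, compact in C by Arzelà–Ascoli, and the remaining map over
time r is continuous from C to W^{1,∞} (`isCompactOperator_of_solutionOperator`). On W^{1,∞},
compose with the inclusion into C. -/

theorem histSegment_eq_of_forall {y z : ℝ → EuclideanSpace ℝ (Fin n)} {t u : ℝ}
    (h : ∀ s : Icc (-r) (0 : ℝ), y (t + s) = z (u + s)) :
    histSegment r y t = histSegment r z u := by
  have h' : (fun s : Icc (-r) (0 : ℝ) => y (t + s)) = fun s : Icc (-r) (0 : ℝ) => z (u + s) :=
    funext h
  unfold histSegment
  by_cases hc : Continuous fun s : Icc (-r) (0 : ℝ) => z (u + s)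
  · rw [dif_pos hc, dif_pos (h' ▸ hc)]
    exact ContinuousMap.ext h
  · rw [dif_neg hc, dif_neg (h' ▸ hc)]

theorem histSegment_congr {y z : ℝ → EuclideanSpace ℝ (Fin n)} {t : ℝ}
    (h : EqOn y z (Icc (t - r) t)) : histSegment r y t = histSegment r z t :=
  histSegment_eq_of_forall fun s => h ⟨by linarith [s.2.1], by linarith [s.2.2]⟩

theorem histSegment_apply {y : ℝ → EuclideanSpace ℝ (Fin n)} {t : ℝ}
    (hy : ContinuousOn y (Icc (t - r) t)) (s : Icc (-r) (0 : ℝ)) :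
    histSegment r y t s = y (t + s) := by
  have h : Continuous fun s : Icc (-r) (0 : ℝ) => y (t + s) :=
    hy.comp_continuous (by fun_prop) fun s => ⟨by linarith [s.2.1], by linarith [s.2.2]⟩
  simp [histSegment, h]

theorem histSegment_sub {y z : ℝ → EuclideanSpace ℝ (Fin n)} (hy : Continuous y)
    (hz : Continuous z) (t : ℝ) :
    histSegment r (y - z) t = histSegment r y t - histSegment r z t := by
  ext1 s
  rw [histSegment_apply (hy.sub hz).continuousOn, ContinuousMap.sub_apply,
    histSegment_apply hy.continuousOn, histSegment_apply hz.continuousOn, Pi.sub_apply]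

theorem continuous_histSegment {y : ℝ → EuclideanSpace ℝ (Fin n)} (hy : Continuous y) :
    Continuous (histSegment r y) := by
  refine ContinuousMap.continuous_of_continuous_uncurry _ ?_
  have h : (Function.uncurry fun t s => histSegment r y t s) =
      fun q : ℝ × Icc (-r) (0 : ℝ) => y (q.1 + q.2) := by
    funext q
    exact histSegment_apply hy.continuousOn q.2
  rw [h]
  fun_prop

theorem norm_histSegment_le {y : ℝ → EuclideanSpace ℝ (Fin n)} {t C : ℝ} (hC : 0 ≤ C)
    (hy : ContinuousOn y (Icc (t - r) t)) (h : ∀ s ∈ Icc (t - r) t, ‖y s‖ ≤ C) :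
    ‖histSegment r y t‖ ≤ C := by
  refine (ContinuousMap.norm_le _ hC).2 fun s => ?_
  rw [histSegment_apply hy]
  exact h _ ⟨by linarith [s.2.1], by linarith [s.2.2]⟩

theorem lipschitzWith_histSegment {y y' : ℝ → EuclideanSpace ℝ (Fin n)} {t : ℝ} {C : ℝ≥0}
    (hy : ∀ s ∈ Icc (t - r) t, HasDerivWithinAt y (y' s) (Icc (t - r) t) s)
    (h : ∀ s ∈ Icc (t - r) t, ‖y' s‖ ≤ C) : LipschitzWith C (histSegment r y t) := by
  have hL := Convex.lipschitzOnWith_of_nnnorm_hasDerivWithin_le (convex_Icc (t - r) t) hy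
    fun s hs => h s hs
  have hc : ContinuousOn y (Icc (t - r) t) := fun s hs => (hy s hs).continuousWithinAt
  intro a b
  rw [histSegment_apply hc, histSegment_apply hc]
  refine (hL ⟨by linarith [a.2.1], by linarith [a.2.2]⟩
    ⟨by linarith [b.2.1], by linarith [b.2.2]⟩).trans_eq ?_
  rw [edist_add_left]
  rfl

/-! ### The norm of W^{1,∞}, and compact sets of Lipschitz functions in C. -/

theorem LipW.toC_ofC {f : HistC n r} (hf : f.IsLip) : (LipW.ofC f).toC = f := by
  have h : f ∈ lipSubmodule n r := hf
  exact congrArg LipW.toC (dif_pos h : LipW.ofC f = (show LipW n r from ⟨f, h⟩))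

theorem HistC.derivSup_le {f : HistC n r} {k : ℝ≥0} (hk : LipschitzWith k f) :
    f.derivSup ≤ k := by
  have h : ∀ᵐ x ∂(volume.restrict (Set.Icc (-r) 0)), ‖f.derivative x‖ ≤ k := by
    -- The end points, where the derivative is one-sided, form a null set.
    rw [← Measure.restrict_congr_set Ioo_ae_eq_Icc, ae_restrict_iff' measurableSet_Ioo]
    refine Filter.Eventually.of_forall fun x hx => ?_
    have hn : Set.Icc (-r) 0 ∈ 𝓝 x := Icc_mem_nhds hx.1 hx.2
    rw [derivative, derivWithin_of_mem_nhds hn]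
    exact norm_deriv_le_of_lipschitzOn hn (lipschitzOnWith_ext hk)
  unfold derivSup
  rw [eLpNorm_exponent_top]
  exact (eLpNormEssSup_le_of_ae_bound h).trans_eq (ENNReal.ofReal_coe_nnreal)

theorem LipW.norm_le {f : LipW n r} {k : ℝ≥0} {C : ℝ} (hk : LipschitzWith k f.toC)
    (hkC : k ≤ C) (hC : ‖f.toC‖ ≤ C) : ‖f‖ ≤ C :=
  max_le hC ((ENNReal.toReal_le_coe_of_le_coe (HistC.derivSup_le hk)).trans hkC)

/-- A common Lipschitz constant gives equicontinuity and survives pointwise limits, so as a set of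
functions this is a closed part of a product of compact balls. -/
theorem isCompact_lipschitzWith (k : ℝ≥0) (C : ℝ) :
    IsCompact {f : HistC n r | LipschitzWith k f ∧ ∀ s, ‖f s‖ ≤ C} := by
  refine ArzelaAscoli.isCompact_of_equicontinuous _ ?_ ?_
  · have h : ContinuousMap.toFun '' {f : HistC n r | LipschitzWith k f ∧ ∀ s, ‖f s‖ ≤ C} =
        {f | LipschitzWith k f} ∩ univ.pi fun _ => Metric.closedBall 0 C := by
      ext g
      constructor
      · rintro ⟨f, hf, rfl⟩
        exact ⟨hf.1, fun s _ => by simpa using hf.2 s⟩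
      · rintro ⟨h1, h2⟩
        exact ⟨⟨g, LipschitzWith.continuous h1⟩, ⟨h1, fun s => by simpa using h2 s trivial⟩, rfl⟩
    rw [h]
    exact (isCompact_univ_pi fun _ => isCompact_closedBall _ _).inter_left
      (isClosed_setOfPred_lipschitzWith k)
  · exact (LipschitzWith.uniformEquicontinuous _ k fun f => f.2.1).equicontinuous

end Segments

/-! ### Linear delay equations -/

section LinearDelay

variable {n : ℕ} {r : ℝ}

/-- `z` solves `z'(t) = A(t) z_t` for `t ≥ 0`, with `z = v` on `[-r,0]`. -/
structure IsDelaySolution (A : ℝ → HistC n r →L[ℝ] EuclideanSpace ℝ (Fin n)) (v : HistC n r)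
    (z : ℝ → EuclideanSpace ℝ (Fin n)) : Prop where
  init : ∀ s : Set.Icc (-r) (0 : ℝ), z s = v s
  cont : ContinuousOn z (Set.Ici (-r))
  deriv : ∀ t : ℝ, 0 ≤ t → HasDerivWithinAt z (A t (histSegment r z t)) (Set.Ici 0) t

/-- `z` is continuous and solves the integrated form of `z'(t) = A(t) z_t`, `z_0 = v`
on `[-r,a]`. -/
structure IsIntegralSolution (A : ℝ → HistC n r →L[ℝ] EuclideanSpace ℝ (Fin n)) (v : HistC n r)
    (a : ℝ) (z : ℝ → EuclideanSpace ℝ (Fin n)) : Prop where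
  cont : Continuous z
  init : ∀ s : Set.Icc (-r) (0 : ℝ), z s = v s
  eq : ∀ t ∈ Icc 0 a, z t = z 0 + ∫ s in (0 : ℝ)..t, A s (histSegment r z s)

/-! ### A priori bounds and uniqueness for the integrated equation. -/

variable {A : ℝ → HistC n r →L[ℝ] EuclideanSpace ℝ (Fin n)}

theorem exists_norm_le_of_stronglyContinuous (hA : ∀ φ, Continuous fun t => A t φ) (a b : ℝ) :
    ∃ M : ℝ≥0, ∀ t ∈ Icc a b, ‖A t‖ ≤ M := by
  obtain ⟨C, hC⟩ := banach_steinhaus (g := fun t : Icc a b => A t) fun φ => by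
    obtain ⟨C, hC⟩ := (isCompact_Icc (a := a) (b := b)).exists_bound_of_continuousOn
      (hA φ).continuousOn
    exact ⟨C, fun t => hC t t.2⟩
  exact ⟨C.toNNReal, fun t ht => (hC ⟨t, ht⟩).trans (Real.le_coe_toNNReal C)⟩

/-- Split A(s)ψ(s) = A(s)(ψ(s) - ψ(t)) + A(s)ψ(t): the local bound on ‖A(s)‖ handles the first term,
strong continuity the second. -/
theorem continuous_apply_of_stronglyContinuous (hA : ∀ φ, Continuous fun t => A t φ)
    {ψ : ℝ → HistC n r} (hψ : Continuous ψ) : Continuous fun t => A t (ψ t) := by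
  refine continuous_iff_continuousAt.2 fun t => ?_
  obtain ⟨M, hM⟩ := exists_norm_le_of_stronglyContinuous hA (t - 1) (t + 1)
  have h1 : Filter.Tendsto (fun s => A s (ψ s - ψ t)) (𝓝 t) (𝓝 0) := by
    refine squeeze_zero_norm' (a := fun s => M * ‖ψ s - ψ t‖) ?_ ?_
    · filter_upwards [Icc_mem_nhds (sub_one_lt t) (lt_add_one t)] with s hs
      exact (A s).le_of_opNorm_le (hM s hs) _
    · have : Continuous fun s => M * ‖ψ s - ψ t‖ := by fun_prop
      simpa using this.tendsto t
  have h2 := h1.add ((hA (ψ t)).tendsto t)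
  simpa [ContinuousAt] using h2

/-- The weight is increasing, so a whole segment is controlled by its value at the right end;
integrating exp(cs) then gains the factor M/c ≤ 1/2. This serves both the a priori bound and the
contraction. -/
theorem norm_integral_delay_le {a c D : ℝ} {M : ℝ≥0}
    (hM : ∀ t ∈ Icc 0 a, ‖A t‖ ≤ M) (hc : 0 < c) (hMc : 2 * M ≤ c) (hD : 0 ≤ D)
    {z : ℝ → EuclideanSpace ℝ (Fin n)} (hz : Continuous z)
    (hzD : ∀ t ∈ Icc (-r) a, ‖z t‖ ≤ D * Real.exp (c * t)) {t : ℝ} (ht : t ∈ Icc 0 a) :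
    ‖∫ s in (0 : ℝ)..t, A s (histSegment r z s)‖ ≤ D / 2 * Real.exp (c * t) := by
  have hg : Continuous fun s => M * D * Real.exp (c * s) := by fun_prop
  have h1 : ‖∫ s in (0 : ℝ)..t, A s (histSegment r z s)‖ ≤
      ∫ s in (0 : ℝ)..t, M * D * Real.exp (c * s) := by
    refine intervalIntegral.norm_integral_le_of_norm_le ht.1
      (Filter.Eventually.of_forall fun s hs => ?_) (hg.intervalIntegrable _ _)
    have hsa : s ≤ a := hs.2.trans ht.2
    have h2 : ‖histSegment r z s‖ ≤ D * Real.exp (c * s) := by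
      refine norm_histSegment_le (by positivity) hz.continuousOn fun q hq => ?_
      refine (hzD q ⟨by linarith [hq.1, hs.1], hq.2.trans hsa⟩).trans ?_
      gcongr
      exact hq.2
    calc ‖A s (histSegment r z s)‖ ≤ M * (D * Real.exp (c * s)) :=
          (A s).le_of_opNorm_le_of_le (hM s ⟨hs.1.le, hsa⟩) h2
      _ = M * D * Real.exp (c * s) := by ring
  have h2 : ∫ s in (0 : ℝ)..t, M * D * Real.exp (c * s) =
      M * D / c * Real.exp (c * t) - M * D / c * Real.exp (c * 0) := by
    refine intervalIntegral.integral_eq_sub_of_hasDerivAt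
      (f := fun s => M * D / c * Real.exp (c * s)) (fun s _ => ?_) (hg.intervalIntegrable _ _)
    have := (((hasDerivAt_id s).const_mul c).exp).const_mul (M * D / c)
    refine this.congr_deriv ?_
    simp only [id]
    field_simp
  have h3 : M * D / c ≤ D / 2 := by
    rw [div_le_div_iff₀ hc two_pos]
    nlinarith
  have h4 : 0 ≤ M * D / c * Real.exp (c * 0) := by positivity
  calc _ ≤ _ := h1
    _ ≤ M * D / c * Real.exp (c * t) := by rw [h2]; linarith
    _ ≤ _ := by gcongr

theorem IsIntegralSolution.mono {v : HistC n r} {a b : ℝ} {z : ℝ → EuclideanSpace ℝ (Fin n)}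
    (h : IsIntegralSolution A v b z) (hab : a ≤ b) : IsIntegralSolution A v a z :=
  ⟨h.cont, h.init, fun t ht => h.eq t ⟨ht.1, ht.2.trans hab⟩⟩

theorem IsIntegralSolution.sub (hA : ∀ φ, Continuous fun t => A t φ) {v w : HistC n r} {a : ℝ}
    {y z : ℝ → EuclideanSpace ℝ (Fin n)} (hy : IsIntegralSolution A v a y)
    (hz : IsIntegralSolution A w a z) : IsIntegralSolution A (v - w) a (y - z) where
  cont := hy.cont.sub hz.cont
  init s := by simp [hy.init, hz.init]
  eq t ht := by
    simp only [histSegment_sub hy.cont hz.cont, map_sub, Pi.sub_apply]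
    rw [intervalIntegral.integral_sub, hy.eq t ht, hz.eq t ht]
    · abel
    · exact (continuous_apply_of_stronglyContinuous hA
        (continuous_histSegment hy.cont)).intervalIntegrable _ _
    · exact (continuous_apply_of_stronglyContinuous hA
        (continuous_histSegment hz.cont)).intervalIntegrable _ _

theorem IsIntegralSolution.exists_bound (hr : 0 ≤ r) (hA : ∀ φ, Continuous fun t => A t φ)
    {a : ℝ} (ha : 0 ≤ a) : ∃ C : ℝ≥0, ∀ v z, IsIntegralSolution A v a z →
      ∀ t ∈ Icc (-r) a, ‖z t‖ ≤ C * ‖v‖ := by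
  obtain ⟨M, hM⟩ := exists_norm_le_of_stronglyContinuous hA 0 a
  -- The summand 1 keeps c positive when M = 0.
  set c : ℝ := 2 * M + 1 with hc
  have hc0 : 0 < c := by positivity
  -- The factor 2 exp(cr) bounds the weighted maximum D by ‖v‖; exp(ca) removes the weight on
  -- [-r,a].
  refine ⟨(2 * Real.exp (c * r) * Real.exp (c * a)).toNNReal, fun v z h => ?_⟩
  obtain ⟨t₀, ht₀, hmax⟩ := (isCompact_Icc (a := -r) (b := a)).exists_isMaxOn
    (nonempty_Icc.2 (by linarith)) (f := fun t => ‖z t‖ / Real.exp (c * t))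
    (Continuous.continuousOn (by
      have := h.cont
      exact this.norm.div (by fun_prop) fun _ => (Real.exp_pos _).ne'))
  set D := ‖z t₀‖ / Real.exp (c * t₀) with hDdef
  have hD : 0 ≤ D := by positivity
  have hzD : ∀ t ∈ Icc (-r) a, ‖z t‖ ≤ D * Real.exp (c * t) := fun t ht =>
    (div_le_iff₀ (Real.exp_pos _)).1 (hmax ht)
  have hv : ∀ t ∈ Icc (-r) 0, ‖z t‖ ≤ ‖v‖ := fun t ht => by
    rw [h.init ⟨t, ht⟩]
    exact v.norm_coe_le_norm _
  -- At the maximum point the left side is D exp(ct₀), so the D/2 term can be absorbed.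
  have hz : ‖z t₀‖ ≤ ‖v‖ + D / 2 * Real.exp (c * t₀) := by
    rcases le_total t₀ 0 with h0 | h0
    · exact (hv t₀ ⟨ht₀.1, h0⟩).trans (le_add_of_nonneg_right (by positivity))
    · rw [h.eq t₀ ⟨h0, ht₀.2⟩]
      exact (norm_add_le _ _).trans (add_le_add (hv 0 ⟨by linarith, le_rfl⟩)
        (norm_integral_delay_le hM hc0 (by linarith) hD h.cont hzD ⟨h0, ht₀.2⟩))
  have hexp : 1 ≤ Real.exp (c * r) * Real.exp (c * t₀) := by
    rw [← Real.exp_add]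
    refine Real.one_le_exp ?_
    nlinarith [ht₀.1]
  have hD2 : D ≤ 2 * Real.exp (c * r) * ‖v‖ := by
    have h1 : ‖z t₀‖ = D * Real.exp (c * t₀) := by
      rw [hDdef, div_mul_cancel₀ _ (Real.exp_pos _).ne']
    have h2 : D * Real.exp (c * t₀) ≤ (2 * Real.exp (c * r) * ‖v‖) * Real.exp (c * t₀) := by
      nlinarith [norm_nonneg v]
    exact le_of_mul_le_mul_right h2 (Real.exp_pos _)
  intro t ht
  calc ‖z t‖ ≤ D * Real.exp (c * t) := hzD t ht
    _ ≤ 2 * Real.exp (c * r) * ‖v‖ * Real.exp (c * a) := by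
        gcongr
        exact ht.2
    _ = _ := by rw [Real.coe_toNNReal _ (by positivity)]; ring

theorem IsIntegralSolution.unique (hr : 0 ≤ r) (hA : ∀ φ, Continuous fun t => A t φ)
    {v : HistC n r} {a : ℝ} (ha : 0 ≤ a) {y z : ℝ → EuclideanSpace ℝ (Fin n)}
    (hy : IsIntegralSolution A v a y) (hz : IsIntegralSolution A v a z) :
    EqOn y z (Icc (-r) a) := by
  obtain ⟨C, hC⟩ := IsIntegralSolution.exists_bound hr hA ha
  intro t ht
  have h := hC _ _ (hy.sub hA hz) t ht
  rw [sub_self, norm_zero, mul_zero] at h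
  exact sub_eq_zero.1 (norm_le_zero_iff.1 h)

/-- The map whose fixed points are the solutions of the integrated equation, in exponential
weights. -/
noncomputable def delayPicard (hA : ∀ φ, Continuous fun t => A t φ) (v : HistC n r) (hr : -r ≤ 0)
    {a : ℝ} (ha : -r ≤ a) (c : ℝ) (w : C(Icc (-r) a, EuclideanSpace ℝ (Fin n))) :
    C(Icc (-r) a, EuclideanSpace ℝ (Fin n)) where
  -- The unknown is w(t) = exp(-ct) z(t). `IccExtend` freezes v(0) for t > 0 and `max t 0` kills the
  -- integral for t < 0, so one formula covers both the initial condition and the equation.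
  toFun t := (Real.exp (c * t))⁻¹ • (IccExtend hr v t +
    ∫ s in (0 : ℝ)..max t 0, A s (histSegment r (fun q => Real.exp (c * q) • IccExtend ha w q) s))
  continuous_toFun := by
    have hw : Continuous fun q : ℝ => Real.exp (c * q) • IccExtend ha w q :=
      (by fun_prop : Continuous fun q : ℝ => Real.exp (c * q)).smul w.continuous.Icc_extend'
    have h1 := intervalIntegral.continuous_primitive (μ := volume) (fun a b =>
      (continuous_apply_of_stronglyContinuous hA
        (continuous_histSegment hw)).intervalIntegrable a b) 0
    have h2 : Continuous fun t : Icc (-r) a => max (t : ℝ) 0 := by fun_prop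
    have h3 : Continuous fun t : Icc (-r) a => IccExtend hr v (t : ℝ) :=
      v.continuous.Icc_extend'.comp continuous_subtype_val
    exact (Continuous.inv₀ (by fun_prop) fun t => (Real.exp_pos _).ne').smul (h3.add (h1.comp h2))

theorem exists_isIntegralSolution (hr : 0 ≤ r) (hA : ∀ φ, Continuous fun t => A t φ)
    (v : HistC n r) {a : ℝ} (ha : 0 ≤ a) : ∃ z, IsIntegralSolution A v a z := by
  obtain ⟨M, hM⟩ := exists_norm_le_of_stronglyContinuous hA 0 a
  set c : ℝ := 2 * M + 1 with hc
  have hc0 : 0 < c := by positivity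
  have hr' : -r ≤ 0 := by linarith
  have ha' : -r ≤ a := by linarith
  set P := delayPicard hA v hr' ha' c with hP
  have hcont : ∀ w : C(Icc (-r) a, EuclideanSpace ℝ (Fin n)),
      Continuous fun q : ℝ => Real.exp (c * q) • IccExtend ha' w q := fun w =>
    (by fun_prop : Continuous fun q : ℝ => Real.exp (c * q)).smul w.continuous.Icc_extend'
  have hint : ∀ (w : C(Icc (-r) a, EuclideanSpace ℝ (Fin n))) (t : ℝ), IntervalIntegrable
      (fun s => A s (histSegment r (fun q => Real.exp (c * q) • IccExtend ha' w q) s))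
      volume 0 t := fun w t =>
    (continuous_apply_of_stronglyContinuous hA
      (continuous_histSegment (hcont w))).intervalIntegrable _ _
  have hlip : ContractingWith 2⁻¹ P := by
    refine ⟨by rw [inv_lt_one₀ two_pos]; exact one_lt_two, LipschitzWith.of_dist_le_mul
      fun w w' => ?_⟩
    refine (ContinuousMap.dist_le (by positivity)).2 fun t => ?_
    rw [dist_eq_norm]
    simp only [hP, delayPicard, ContinuousMap.coe_mk]
    rw [← smul_sub, add_sub_add_left_eq_sub, ← intervalIntegral.integral_sub (hint _ _) (hint _ _),
      norm_smul, norm_inv, Real.norm_of_nonneg (Real.exp_pos _).le]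
    rcases le_total (t : ℝ) 0 with h0 | h0
    · rw [max_eq_right h0, intervalIntegral.integral_same, norm_zero, mul_zero]
      positivity
    · have hb := norm_integral_delay_le (r := r) hM hc0 (by linarith)
        (dist_nonneg (x := w) (y := w')) ((hcont w).sub (hcont w')) (fun q hq => by
          simp only [← smul_sub, norm_smul, Real.norm_of_nonneg (Real.exp_pos _).le,
            Pi.sub_apply, IccExtend_of_mem ha' _ hq]
          rw [mul_comm, ← dist_eq_norm]
          gcongr
          exact ContinuousMap.dist_apply_le_dist _) ⟨h0, t.2.2⟩
      have hsub := fun s => histSegment_sub (r := r) (hcont w) (hcont w') s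
      simp only [hsub, map_sub] at hb
      rw [max_eq_left h0, inv_mul_le_iff₀ (Real.exp_pos _)]
      refine hb.trans_eq ?_
      push_cast
      ring
  obtain ⟨w, hw⟩ : ∃ w, P w = w := ⟨_, hlip.fixedPoint_isFixedPt⟩
  have hz : ∀ t ∈ Icc (-r) a, Real.exp (c * t) • IccExtend ha' w t = IccExtend hr' v t +
      ∫ s in (0 : ℝ)..max t 0,
        A s (histSegment r (fun q => Real.exp (c * q) • IccExtend ha' w q) s) := fun t ht => by
    have h := DFunLike.congr_fun hw ⟨t, ht⟩
    simp only [hP, delayPicard, ContinuousMap.coe_mk] at h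
    rw [inv_smul_eq_iff₀ (Real.exp_pos _).ne'] at h
    rw [IccExtend_of_mem ha' _ ht, ← h]
  have hz0 : ∀ t ∈ Icc (-r) 0, Real.exp (c * t) • IccExtend ha' w t = IccExtend hr' v t :=
    fun t ht => by
      rw [hz t ⟨ht.1, ht.2.trans ha⟩, max_eq_right ht.2, intervalIntegral.integral_same, add_zero]
  refine ⟨fun q => Real.exp (c * q) • IccExtend ha' w q, hcont w, fun s => ?_, fun t ht => ?_⟩
  · rw [hz0 s s.2, IccExtend_val]
  · rw [hz0 0 ⟨hr', le_rfl⟩, hz t ⟨hr'.trans ht.1, ht.2⟩, max_eq_left ht.1,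
      IccExtend_of_right_le hr' _ ht.1, IccExtend_right]

/-! ### Passage between the integrated and the differential equation; global solutions. -/

theorem IsIntegralSolution.hasDerivWithinAt (hA : ∀ φ, Continuous fun t => A t φ) {v : HistC n r}
    {a : ℝ} {z : ℝ → EuclideanSpace ℝ (Fin n)} (h : IsIntegralSolution A v a z) {t : ℝ}
    (ht : 0 ≤ t) (hta : t < a) :
    HasDerivWithinAt z (A t (histSegment r z t)) (Ici 0) t := by
  have h1 := ((continuous_apply_of_stronglyContinuous hA
    (continuous_histSegment h.cont)).integral_hasStrictDerivAt 0 t).hasDerivAt.const_add (z 0)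
  refine (h1.hasDerivWithinAt (s := Ici 0)).congr_of_eventuallyEq ?_ (h.eq t ⟨ht, hta.le⟩)
  filter_upwards [self_mem_nhdsWithin, mem_nhdsWithin_of_mem_nhds (Iio_mem_nhds hta)] with s hs hs'
  exact h.eq s ⟨hs, le_of_lt hs'⟩

/-- Values to the left of -r never enter the equation; freezing them there makes the function
continuous on ℝ, and the fundamental theorem of calculus applies. -/
theorem IsDelaySolution.isIntegralSolution (hr : 0 ≤ r) (hA : ∀ φ, Continuous fun t => A t φ)
    {v : HistC n r} {z : ℝ → EuclideanSpace ℝ (Fin n)} (h : IsDelaySolution A v z) (a : ℝ) :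
    IsIntegralSolution A v a fun t => z (max t (-r)) := by
  have hc : Continuous fun t => z (max t (-r)) :=
    h.cont.comp_continuous (by fun_prop) fun t => mem_Ici.2 (le_max_right _ _)
  refine ⟨hc, fun s => ?_, fun t ht => ?_⟩
  · rw [max_eq_left s.2.1, h.init]
  · rw [intervalIntegral.integral_eq_sub_of_hasDerivAt_of_le ht.1 (f := fun t => z (max t (-r)))
      hc.continuousOn (fun s hs => ?_) ((continuous_apply_of_stronglyContinuous hA
        (continuous_histSegment hc)).intervalIntegrable _ _)]
    · abel
    · have h1 := (h.deriv s hs.1.le).hasDerivAt (Ici_mem_nhds hs.1)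
      have h2 : histSegment r (fun t => z (max t (-r))) s = histSegment r z s :=
        histSegment_congr fun q hq => by
          rw [max_eq_left (by linarith [hq.1, hs.1])]
      rw [h2]
      refine h1.congr_of_eventuallyEq ?_
      filter_upwards [Ioi_mem_nhds hs.1] with q hq
      rw [max_eq_left (by linarith [mem_Ioi.1 hq])]

theorem IsDelaySolution.unique (hr : 0 ≤ r) (hA : ∀ φ, Continuous fun t => A t φ)
    {v : HistC n r} {y z : ℝ → EuclideanSpace ℝ (Fin n)} (hy : IsDelaySolution A v y)
    (hz : IsDelaySolution A v z) : EqOn y z (Ici (-r)) := by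
  intro t ht
  have h := IsIntegralSolution.unique hr hA (le_max_right t 0)
    (hy.isIntegralSolution hr hA _) (hz.isIntegralSolution hr hA _) ⟨ht, le_max_left _ _⟩
  simpa [max_eq_left (mem_Ici.1 ht)] using h

/-- Solutions on [-r,N] agree on overlaps by uniqueness and are glued. -/
theorem exists_isDelaySolution (hr : 0 ≤ r) (hA : ∀ φ, Continuous fun t => A t φ)
    (v : HistC n r) : ∃ z, IsDelaySolution A v z := by
  choose y hy using fun N : ℕ => exists_isIntegralSolution hr hA v (Nat.cast_nonneg (α := ℝ) N)
  have hyy : ∀ (N N' : ℕ) (t : ℝ), -r ≤ t → t ≤ N → t ≤ N' → y N t = y N' t := by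
    intro N N' t h1 h2 h3
    wlog hN : N ≤ N' generalizing N N'
    · exact (this N' N h3 h2 (le_of_not_ge hN)).symm
    · exact IsIntegralSolution.unique hr hA (Nat.cast_nonneg _) (hy N)
        ((hy N').mono (Nat.cast_le.2 hN)) ⟨h1, h2⟩
  set z : ℝ → EuclideanSpace ℝ (Fin n) := fun t => y ⌈t⌉₊ t with hz
  have hzy : ∀ (N : ℕ) (t : ℝ), -r ≤ t → t ≤ N → z t = y N t := fun N t h1 h2 =>
    hyy _ _ t h1 (Nat.le_ceil t) h2
  refine ⟨z, fun s => ?_, fun t ht => ?_, fun t ht => ?_⟩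
  · rw [hzy 0 s s.2.1 (by simpa using s.2.2), (hy 0).init]
  · obtain ⟨N, hN⟩ := exists_nat_gt t
    refine (hy N).cont.continuousWithinAt.congr_of_eventuallyEq ?_ (hzy N t ht hN.le)
    filter_upwards [self_mem_nhdsWithin, mem_nhdsWithin_of_mem_nhds (Iio_mem_nhds hN)] with s hs hs'
    exact hzy N s hs (le_of_lt hs')
  -- The strict inequality t < N makes z equal to one fixed `y N` on a whole neighbourhood of t in
  -- [0,∞), so the derivative carries over.
  · obtain ⟨N, hN⟩ := exists_nat_gt t
    have h1 : histSegment r z t = histSegment r (y N) t := histSegment_congr fun s hs =>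
      hzy N s (by linarith [hs.1]) (hs.2.trans hN.le)
    rw [h1]
    refine ((hy N).hasDerivWithinAt hA ht hN).congr_of_eventuallyEq ?_
      (hzy N t (by linarith) hN.le)
    filter_upwards [self_mem_nhdsWithin, mem_nhdsWithin_of_mem_nhds (Iio_mem_nhds hN)] with s hs hs'
    exact hzy N s (by linarith [mem_Ici.1 hs]) (le_of_lt hs')

/-! ### Linearity, time translation, and the solution operator. -/

theorem IsDelaySolution.continuousOn_Icc {v : HistC n r} {z : ℝ → EuclideanSpace ℝ (Fin n)}
    (h : IsDelaySolution A v z) {t : ℝ} (ht : 0 ≤ t) : ContinuousOn z (Icc (t - r) t) :=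
  h.cont.mono fun s hs => by simpa using by linarith [hs.1]

theorem IsDelaySolution.add {v w : HistC n r} {y z : ℝ → EuclideanSpace ℝ (Fin n)}
    (hy : IsDelaySolution A v y) (hz : IsDelaySolution A w z) :
    IsDelaySolution A (v + w) (y + z) where
  init s := by simp [hy.init, hz.init]
  cont := hy.cont.add hz.cont
  deriv t ht := by
    have h : histSegment r (y + z) t = histSegment r y t + histSegment r z t := by
      ext1 s
      rw [histSegment_apply ((hy.continuousOn_Icc ht).add (hz.continuousOn_Icc ht)),
        ContinuousMap.add_apply, histSegment_apply (hy.continuousOn_Icc ht),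
        histSegment_apply (hz.continuousOn_Icc ht), Pi.add_apply]
    rw [h, map_add]
    exact (hy.deriv t ht).add (hz.deriv t ht)

theorem IsDelaySolution.smul (c : ℝ) {v : HistC n r} {z : ℝ → EuclideanSpace ℝ (Fin n)}
    (hz : IsDelaySolution A v z) : IsDelaySolution A (c • v) (c • z) where
  init s := by simp [hz.init]
  cont := hz.cont.const_smul c
  deriv t ht := by
    have h : histSegment r (c • z) t = c • histSegment r z t := by
      ext1 s
      rw [histSegment_apply ((hz.continuousOn_Icc ht).const_smul c),
        ContinuousMap.smul_apply, histSegment_apply (hz.continuousOn_Icc ht), Pi.smul_apply]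
    rw [h, map_smul]
    exact (hz.deriv t ht).const_smul c

theorem IsDelaySolution.shift {v : HistC n r} {z : ℝ → EuclideanSpace ℝ (Fin n)}
    (hz : IsDelaySolution A v z) {b : ℝ} (hb : 0 ≤ b) :
    IsDelaySolution (fun t => A (b + t)) (histSegment r z b) fun t => z (b + t) where
  init s := (histSegment_apply (hz.continuousOn_Icc hb) s).symm
  cont := hz.cont.comp (by fun_prop) fun t ht => by
    have := mem_Ici.1 ht
    exact mem_Ici.2 (by linarith)
  deriv t ht := by
    have h : histSegment r (fun t => z (b + t)) t = histSegment r z (b + t) :=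
      histSegment_eq_of_forall fun s => by rw [add_assoc]
    rw [h]
    have h1 := (hz.deriv (b + t) (by linarith)).scomp t
      (((hasDerivAt_id t).const_add b).hasDerivWithinAt (s := Ici 0)) fun s hs => by
        have := mem_Ici.1 hs
        exact mem_Ici.2 (by linarith)
    simpa [Function.comp_def] using h1

/-- Solutions at time `T ≥ r` are bounded in `C`, and in their Lipschitz constant, by the datum. -/
theorem IsDelaySolution.exists_lipschitz_bound (hr : 0 ≤ r)
    (hA : ∀ φ, Continuous fun t => A t φ) {T : ℝ} (hT : r ≤ T) :
    ∃ C : ℝ≥0, ∀ v z, IsDelaySolution A v z →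
      LipschitzWith (C * ‖v‖₊) (histSegment r z T) ∧ ‖histSegment r z T‖ ≤ C * ‖v‖ := by
  have hT0 : 0 ≤ T := hr.trans hT
  obtain ⟨M, hM⟩ := exists_norm_le_of_stronglyContinuous hA 0 T
  obtain ⟨C, hC⟩ := IsIntegralSolution.exists_bound hr hA hT0
  -- C bounds z on [-r,T] and M * C bounds z' on [0,T], both relative to ‖v‖.
  refine ⟨max C (M * C), fun v z h => ?_⟩
  have hb : ∀ t ∈ Icc (-r) T, ‖z t‖ ≤ C * ‖v‖ := fun t ht => by
    have := hC v _ (h.isIntegralSolution hr hA T) t ht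
    rwa [max_eq_left ht.1] at this
  have hseg : ∀ t ∈ Icc 0 T, ‖histSegment r z t‖ ≤ C * ‖v‖ := fun t ht =>
    norm_histSegment_le (by positivity) (h.continuousOn_Icc ht.1) fun s hs =>
      hb s ⟨by linarith [hs.1, ht.1], hs.2.trans ht.2⟩
  constructor
  -- This is where T ≥ r enters: the window avoids the initial function, which need not be
  -- Lipschitz.
  · have hsub : ∀ s ∈ Icc (T - r) T, s ∈ Icc 0 T := fun s hs => ⟨by linarith [hs.1], hs.2⟩
    refine lipschitzWith_histSegment (y' := fun t => A t (histSegment r z t))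
      (fun s hs => (h.deriv s (hsub s hs).1).mono fun q hq => (hsub q hq).1) fun s hs => ?_
    refine ((A s).le_of_opNorm_le_of_le (hM s (hsub s hs)) (hseg s (hsub s hs))).trans ?_
    push_cast
    rw [← mul_assoc]
    gcongr
    exact le_max_right _ _
  · refine (hseg T ⟨hT0, le_rfl⟩).trans ?_
    gcongr
    exact le_max_left _ _

/-- The solution operator `v ↦ z_T` as a bounded operator from `C` to `W^{1,∞}`, `T ≥ r`. -/
theorem exists_solutionOperator (hr : 0 ≤ r) (hA : ∀ φ, Continuous fun t => A t φ) {T : ℝ}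
    (hT : r ≤ T) : ∃ U : HistC n r →L[ℝ] LipW n r,
      ∀ v z, IsDelaySolution A v z → (U v).toC = histSegment r z T := by
  have hT0 : 0 ≤ T := hr.trans hT
  obtain ⟨C, hC⟩ := IsDelaySolution.exists_lipschitz_bound hr hA hT
  choose Z hZ using exists_isDelaySolution hr hA
  have hlip : ∀ v, (histSegment r (Z v) T).IsLip := fun v => ⟨_, (hC v _ (hZ v)).1⟩
  -- By uniqueness any solution may replace the chosen `Z v`; applied to sums and multiples of
  -- solutions this yields linearity.
  have happ : ∀ v z, IsDelaySolution A v z → ∀ s, histSegment r (Z v) T s = z (T + s) := by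
    intro v z hz s
    rw [histSegment_apply ((hZ v).continuousOn_Icc hT0)]
    exact (hZ v).unique hr hA hz (mem_Ici.2 (by linarith [s.2.1]))
  let U : HistC n r →ₗ[ℝ] LipW n r :=
    { toFun := fun v => LipW.ofC (histSegment r (Z v) T)
      map_add' := fun v w => by
        apply LipW.toC_injective
        rw [map_add, LipW.toC_ofC (hlip _), LipW.toC_ofC (hlip _), LipW.toC_ofC (hlip _)]
        ext1 s
        rw [happ _ _ ((hZ v).add (hZ w)), ContinuousMap.add_apply, happ _ _ (hZ v),
          happ _ _ (hZ w), Pi.add_apply]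
      map_smul' := fun c v => by
        apply LipW.toC_injective
        rw [map_smul, LipW.toC_ofC (hlip _), LipW.toC_ofC (hlip _)]
        ext1 s
        rw [happ _ _ ((hZ v).smul c), RingHom.id_apply, ContinuousMap.smul_apply, happ _ _ (hZ v),
          Pi.smul_apply] }
  have hU : ∀ v, (U v).toC = histSegment r (Z v) T := fun v => LipW.toC_ofC (hlip v)
  refine ⟨U.mkContinuous C fun v => LipW.norm_le (k := C * ‖v‖₊) ?_ (by simp) ?_,
    fun v z hz => ?_⟩
  · rw [hU]
    exact (hC v _ (hZ v)).1
  · rw [hU]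
    exact (hC v _ (hZ v)).2
  · rw [LinearMap.mkContinuous_apply, hU]
    ext1 s
    rw [happ v z hz, histSegment_apply (hz.continuousOn_Icc hT0)]

/-- The first stage, up to T - r, gains compactness in C; the second, of length r, turns convergence
in C into convergence in W^{1,∞}. -/
theorem isCompactOperator_of_solutionOperator (hr : 0 ≤ r) (hA : ∀ φ, Continuous fun t => A t φ)
    {T : ℝ} (hT : 2 * r ≤ T) (U : HistC n r →L[ℝ] LipW n r)
    (hU : ∀ v z, IsDelaySolution A v z → (U v).toC = histSegment r z T) :
    IsCompactOperator U := by
  have hTr : 0 ≤ T - r := by linarith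
  obtain ⟨C, hC⟩ := IsDelaySolution.exists_lipschitz_bound hr hA (T := T - r) (by linarith)
  obtain ⟨V, hV⟩ := exists_solutionOperator hr (A := fun t => A (T - r + t))
    (fun φ => (hA φ).comp (by fun_prop)) le_rfl
  refine ⟨V '' _, (isCompact_lipschitzWith C C).image V.continuous, ?_⟩
  filter_upwards [Metric.closedBall_mem_nhds (0 : HistC n r) one_pos] with v hv
  have hv1 : ‖v‖ ≤ 1 := by simpa using hv
  obtain ⟨z, hz⟩ := exists_isDelaySolution hr hA v
  obtain ⟨h1, h2⟩ := hC v z hz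
  refine ⟨histSegment r z (T - r), ⟨h1.weaken (mul_le_of_le_one_right' hv1), fun s =>
    (ContinuousMap.norm_coe_le_norm _ s).trans
      (h2.trans (mul_le_of_le_one_right C.2 hv1))⟩, LipW.toC_injective ?_⟩
  rw [hU v z hz, hV _ _ (hz.shift hTr)]
  exact histSegment_eq_of_forall fun s => by rw [← add_assoc, sub_add_cancel]

end LinearDelay

/-! ### The delay system along a trajectory -/

theorem HistC.derivative_histSegment {n : ℕ} {r : ℝ} (hr : 0 < r)
    {y : ℝ → EuclideanSpace ℝ (Fin n)} {t s : ℝ} {d : EuclideanSpace ℝ (Fin n)}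
    (hy : ContinuousOn y (Icc (t - r) t)) (hs : s ∈ Icc (-r) 0)
    (hd : HasDerivWithinAt y d (Icc (t - r) t) (t + s)) :
    (histSegment r y t).derivative s = d := by
  have h1 := hd.scomp s (((hasDerivAt_id s).const_add t).hasDerivWithinAt (s := Icc (-r) 0))
    fun q hq => by
      have h2 := hq.1
      have h3 := hq.2
      exact ⟨by linarith, by linarith⟩
  rw [one_smul] at h1
  refine (h1.congr_of_mem (fun q hq => ?_) hs).derivWithin
    (uniqueDiffOn_Icc (by linarith) s hs)
  simp only [HistC.ext, hq, dif_pos, Function.comp_def]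
  exact histSegment_apply hy _

namespace DelaySystem

variable {Ω : Type*} [TopologicalSpace Ω] {n : ℕ} {r : ℝ} {S : DelaySystem Ω n r}

/-- The right-hand side of the delay equation along `y`. -/
noncomputable def rhs (S : DelaySystem Ω n r) (ω : Ω) (y : ℝ → EuclideanSpace ℝ (Fin n)) (t : ℝ) :
    EuclideanSpace ℝ (Fin n) :=
  S.F (S.σ t ω) (y t) (y (t - S.τ (S.σ t ω) (histSegment r y t)))

theorem continuous_delay (hτ : S.DelayRegular) (ω : Ω) {y : ℝ → EuclideanSpace ℝ (Fin n)}
    (hy : Continuous y) : Continuous fun t => S.τ (S.σ t ω) (histSegment r y t) :=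
  hτ.cont.comp ((S.σ.continuous continuous_id continuous_const).prodMk (continuous_histSegment hy))

theorem continuous_rhs (hF : S.FieldRegular) (hτ : S.DelayRegular) (ω : Ω)
    {y : ℝ → EuclideanSpace ℝ (Fin n)} (hy : Continuous y) : Continuous (S.rhs ω y) :=
  hF.cont.comp ((S.σ.continuous continuous_id continuous_const).prodMk
    (hy.prodMk (hy.comp (continuous_id.sub (continuous_delay hτ ω hy)))))

/-- The default value has lifetime 0, so an infinite lifetime forces a genuine maximal solution. -/
theorem isSolution_maximal {p : Ω × LipW n r} (hp : S.lifetime p = ⊤) :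
    S.IsSolution p.1 p.2.toC ⊤ (S.maximal p.1 p.2).2 := by
  by_cases h : ∃ q : EReal × (ℝ → EuclideanSpace ℝ (Fin n)),
      S.IsMaximalSolution p.1 p.2.toC q.1 q.2
  · have h1 : S.maximal p.1 p.2 = h.choose := dif_pos h
    have h2 := h.choose_spec.sol
    rw [← h1] at h2
    rwa [show (S.maximal p.1 p.2).1 = ⊤ from hp] at h2
  · have h1 : S.maximal p.1 p.2 = (0, fun _ => 0) := dif_neg h
    simp [lifetime, h1] at hp

theorem IsSolution.exists_continuous {ω : Ω} {x : HistC n r} {y : ℝ → EuclideanSpace ℝ (Fin n)}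
    (h : S.IsSolution ω x ⊤ y) : ∃ z : ℝ → EuclideanSpace ℝ (Fin n), Continuous z ∧
      EqOn z y (Ici (-r)) ∧ ∀ t, 0 ≤ t → HasDerivWithinAt z (S.rhs ω z t) (Ici 0) t := by
  have hr : 0 ≤ r := (S.τ_mem ω x).1.trans (S.τ_mem ω x).2
  have heq : EqOn (fun t => y (max t (-r))) y (Ici (-r)) := fun t ht => by
    simp only [max_eq_left (mem_Ici.1 ht)]
  refine ⟨fun t => y (max t (-r)), ?_, heq, fun t ht => ?_⟩
  · exact h.cont.comp_continuous (by fun_prop) fun t => ⟨le_max_right _ _, EReal.coe_lt_top _⟩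
  · have h1 : histSegment r (fun t => y (max t (-r))) t = histSegment r y t :=
      histSegment_congr fun s hs => heq (mem_Ici.2 (by linarith [hs.1]))
    have hτ := S.τ_mem (S.σ t ω) (histSegment r y t)
    have h2 : S.rhs ω (fun t => y (max t (-r))) t = S.rhs ω y t := by
      unfold rhs
      rw [h1]
      congr 1
      · exact heq (mem_Ici.2 (by linarith))
      · exact heq (mem_Ici.2 (by linarith [hτ.2]))
    rw [h2]
    exact (h.deriv t ht (EReal.coe_lt_top _)).congr_of_mem
      (fun s hs => heq (mem_Ici.2 (by linarith [mem_Ici.1 hs]))) ht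

theorem isLip_histSegment_of_hasDerivWithinAt {y y' : ℝ → EuclideanSpace ℝ (Fin n)} {t : ℝ}
    (hy' : Continuous y')
    (hy : ∀ s ∈ Icc (t - r) t, HasDerivWithinAt y (y' s) (Icc (t - r) t) s) :
    (histSegment r y t).IsLip := by
  obtain ⟨C, hC⟩ := (isCompact_Icc (a := t - r) (b := t)).exists_bound_of_continuousOn
    hy'.continuousOn
  exact ⟨C.toNNReal, lipschitzWith_histSegment hy fun s hs =>
    (hC s hs).trans (Real.le_coe_toNNReal C)⟩

/-- The trajectory through a point of `K` is of class `C¹` on `[-r,∞)`. -/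
theorem exists_trajectory (hr : 0 < r) (hF : S.FieldRegular) (hτ : S.DelayRegular)
    {K : Set (Ω × LipW n r)} (hKinv : S.PositivelyInvariant K) {p : Ω × LipW n r} (hp : p ∈ K)
    (hback : S.HasBackwardExtension K p) :
    ∃ y y' : ℝ → EuclideanSpace ℝ (Fin n), Continuous y ∧ Continuous y' ∧
      (∀ t, -r ≤ t → HasDerivWithinAt y (y' t) (Ici (-r)) t) ∧
      ∀ t, 0 ≤ t → (S.u t p).toC = histSegment r y t := by
  obtain ⟨θ, -, hθK, hθ0, hθ⟩ := hback
  -- The point of the backward orbit r time units earlier: its solution w over [0,r] is the initial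
  -- function of p.
  set q := θ (-r) with hq
  have hqp : S.semiflow r q = p := by
    rw [hq, hθ (-r) r le_rfl (by linarith), add_neg_cancel, hθ0]
  have hσ : S.σ r q.1 = p.1 := congrArg Prod.fst hqp
  have hu : S.u r q = p.2 := congrArg Prod.snd hqp
  have hsolp := isSolution_maximal (hKinv p hp).1
  obtain ⟨y, hyc, hy, hyd⟩ := hsolp.exists_continuous
  obtain ⟨w, hwc, hw, hwd⟩ :=
    (isSolution_maximal (hKinv q (hθK _ (by linarith))).1).exists_continuous
  have hwseg : p.2.toC = histSegment r w r := by
    have h1 : histSegment r (S.maximal q.1 q.2).2 r = histSegment r w r :=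
      histSegment_congr fun s hs => (hw (mem_Ici.2 (by linarith [hs.1]))).symm
    rw [← hu, u, h1, LipW.toC_ofC]
    refine isLip_histSegment_of_hasDerivWithinAt (continuous_rhs hF hτ q.1 hwc) fun s hs => ?_
    rw [sub_self] at hs ⊢
    exact (hwd s hs.1).mono Icc_subset_Ici_self
  have hyw : ∀ s ∈ Icc (-r) 0, y s = w (r + s) := fun s hs => by
    rw [hy hs.1, hsolp.init ⟨s, hs⟩, hwseg, histSegment_apply hwc.continuousOn]
  have hseg0 : histSegment r y 0 = histSegment r w r :=
    histSegment_eq_of_forall fun s => by rw [zero_add, hyw s s.2]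
  -- Matching at the junction: the derivative of w at time r, which is the left derivative of y at
  -- 0, equals the right derivative given by the equation for p.
  have hrhs0 : S.rhs q.1 w (r + 0) = S.rhs p.1 y 0 := by
    have h0 : S.σ 0 p.1 = p.1 := S.σ.map_zero_apply _
    have h1 := S.τ_mem p.1 (histSegment r w r)
    unfold rhs
    rw [add_zero, hσ, h0, hseg0, hyw 0 ⟨by linarith, le_rfl⟩,
      hyw (0 - _) ⟨by linarith [h1.2], by linarith [h1.1]⟩, add_zero, zero_sub, ← sub_eq_add_neg]
  have hwrc := continuous_rhs hF hτ q.1 hwc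
  have hyrc := continuous_rhs hF hτ p.1 hyc
  set y' : ℝ → EuclideanSpace ℝ (Fin n) := fun t =>
    if t ≤ 0 then S.rhs q.1 w (r + t) else S.rhs p.1 y t with hy'
  have hy'c : Continuous y' := by
    refine Continuous.if_le (by fun_prop) hyrc continuous_id continuous_const fun t ht => ?_
    rw [show t = 0 from ht, hrhs0]
  have hy'pos : ∀ t, 0 ≤ t → y' t = S.rhs p.1 y t := fun t ht => by
    rcases ht.eq_or_lt with rfl | h
    · simp only [hy', le_refl, if_true, hrhs0]
    · simp only [hy', not_le.2 h, if_false]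
  have hleft : ∀ t ∈ Icc (-r) 0, HasDerivWithinAt y (y' t) (Icc (-r) 0) t := fun t ht => by
    have h1 := (hwd (r + t) (by linarith [ht.1])).scomp t
      (((hasDerivAt_id t).const_add r).hasDerivWithinAt (s := Icc (-r) 0)) fun s hs => by
        have := hs.1
        exact mem_Ici.2 (by linarith)
    rw [one_smul] at h1
    simp only [hy', ht.2, if_true]
    exact h1.congr_of_mem (fun s hs => hyw s hs) ht
  have hright : ∀ t, 0 ≤ t → HasDerivWithinAt y (y' t) (Ici 0) t := fun t ht => by
    rw [hy'pos t ht]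
    exact hyd t ht
  have hderiv : ∀ t, -r ≤ t → HasDerivWithinAt y (y' t) (Ici (-r)) t := fun t ht => by
    rcases lt_trichotomy t 0 with h | rfl | h
    · refine (hleft t ⟨ht, h.le⟩).mono_of_mem_nhdsWithin ?_
      filter_upwards [self_mem_nhdsWithin, mem_nhdsWithin_of_mem_nhds (Iio_mem_nhds h)]
        with s hs hs'
      exact ⟨hs, le_of_lt hs'⟩
    · refine ((hleft 0 ⟨ht, le_rfl⟩).union (hright 0 le_rfl)).mono fun s hs => ?_
      exact (le_total s 0).imp (fun h => ⟨hs, h⟩) fun h => h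
    · exact ((hright t h.le).hasDerivAt (Ici_mem_nhds h)).hasDerivWithinAt
  refine ⟨y, y', hyc, hy'c, hderiv, fun t ht => ?_⟩
  have h1 : histSegment r (S.maximal p.1 p.2).2 t = histSegment r y t :=
    histSegment_congr fun s hs => (hy (mem_Ici.2 (by linarith [hs.1]))).symm
  rw [u, h1, LipW.toC_ofC]
  refine isLip_histSegment_of_hasDerivWithinAt hy'c fun s hs => ?_
  exact (hderiv s (by linarith [hs.1])).mono fun v hv => mem_Ici.2 (by linarith [hv.1])

/-- The evaluation points carry proofs that depend on the history; a free ψ allows the whole history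
to be replaced at once. -/
theorem L_apply (p : Ω × LipW n r) (φ : HistC n r) {ψ : HistC n r} (h : p.2.toC = ψ) :
    S.L p φ = S.D₂F p.1 (ψ ⟨0, S.zero_mem p.1 ψ⟩) (ψ ⟨-S.τ p.1 ψ, S.neg_τ_mem p.1 ψ⟩)
        (φ ⟨0, S.zero_mem p.1 ψ⟩)
      + S.D₃F p.1 (ψ ⟨0, S.zero_mem p.1 ψ⟩) (ψ ⟨-S.τ p.1 ψ, S.neg_τ_mem p.1 ψ⟩)
        (φ ⟨-S.τ p.1 ψ, S.neg_τ_mem p.1 ψ⟩)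
      - S.D₂τ p.1 ψ φ • S.D₃F p.1 (ψ ⟨0, S.zero_mem p.1 ψ⟩)
        (ψ ⟨-S.τ p.1 ψ, S.neg_τ_mem p.1 ψ⟩) (ψ.derivative (-S.τ p.1 ψ)) := by
  subst h
  rfl

/-- The linearization along the trajectory of a point of `K` depends strongly continuously
on time. -/
theorem continuous_L_semiflow (hr : 0 < r) (hF : S.FieldRegular) (hτ : S.DelayRegular)
    {K : Set (Ω × LipW n r)} (hKinv : S.PositivelyInvariant K) {p : Ω × LipW n r} (hp : p ∈ K)
    (hback : S.HasBackwardExtension K p) (φ : HistC n r) :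
    Continuous fun t => S.L (S.semiflow (max t 0) p) φ := by
  obtain ⟨y, y', hy, hy', hd, hu⟩ := exists_trajectory hr hF hτ hKinv hp hback
  have hfun : ∀ t, S.L (S.semiflow (max t 0) p) φ =
      S.D₂F (S.σ (max t 0) p.1) (y (max t 0))
        (y (max t 0 - S.τ (S.σ (max t 0) p.1) (histSegment r y (max t 0))))
        (φ ⟨0, S.zero_mem (S.σ (max t 0) p.1) (histSegment r y (max t 0))⟩)
      + S.D₃F (S.σ (max t 0) p.1) (y (max t 0))
        (y (max t 0 - S.τ (S.σ (max t 0) p.1) (histSegment r y (max t 0))))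
        (φ ⟨-S.τ (S.σ (max t 0) p.1) (histSegment r y (max t 0)),
          S.neg_τ_mem (S.σ (max t 0) p.1) (histSegment r y (max t 0))⟩)
      - S.D₂τ (S.σ (max t 0) p.1) (histSegment r y (max t 0)) φ •
        S.D₃F (S.σ (max t 0) p.1) (y (max t 0))
          (y (max t 0 - S.τ (S.σ (max t 0) p.1) (histSegment r y (max t 0))))
          (y' (max t 0 - S.τ (S.σ (max t 0) p.1) (histSegment r y (max t 0)))) := fun t => by
    have hm : 0 ≤ max t 0 := le_max_right _ _
    have hmem := S.neg_τ_mem (S.σ (max t 0) p.1) (histSegment r y (max t 0))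
    rw [L_apply _ φ (ψ := histSegment r y (max t 0)) (hu _ hm)]
    simp only [semiflow]
    rw [HistC.derivative_histSegment hr hy.continuousOn hmem (d := y' (max t 0 +
        -S.τ (S.σ (max t 0) p.1) (histSegment r y (max t 0))))
      ((hd _ (by linarith [hmem.1])).mono fun s hs => mem_Ici.2 (by linarith [hs.1])),
      histSegment_apply hy.continuousOn, histSegment_apply hy.continuousOn]
    simp only [add_zero, ← sub_eq_add_neg]
  simp only [hfun]
  have hm : Continuous fun t : ℝ => max t 0 := by fun_prop
  have hσ : Continuous fun t => S.σ (max t 0) p.1 := S.σ.continuous hm continuous_const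
  have hseg : Continuous fun t => histSegment r y (max t 0) := (continuous_histSegment hy).comp hm
  have hdel : Continuous fun t : ℝ =>
      S.τ (S.σ (max t 0) p.1) (histSegment r y (max t 0)) := (continuous_delay hτ p.1 hy).comp hm
  have hlag : Continuous fun t : ℝ =>
      max t 0 - S.τ (S.σ (max t 0) p.1) (histSegment r y (max t 0)) := hm.sub hdel
  have harg := hσ.prodMk ((hy.comp hm).prodMk (hy.comp hlag))
  have h₂ := hF.cont₂.comp harg
  have h₃ := hF.cont₃.comp harg
  refine Continuous.sub (Continuous.add ?_ ?_) ?_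
  · exact h₂.clm_apply (φ.continuous.comp (continuous_const.subtype_mk _))
  -- Continuity of the fixed function φ suffices for the moving evaluation point.
  · exact h₃.clm_apply (φ.continuous.comp (hdel.neg.subtype_mk _))
  -- The only use of the C¹ regularity of the trajectory on all of [-r,∞): the lagged time may be
  -- negative.
  · exact ((hτ.cont_deriv.comp (hσ.prodMk hseg)).clm_apply continuous_const).smul
      (h₃.clm_apply (hy'.comp hlag))

/-- The semiflow is meaningful only for t ≥ 0; `max t 0` freezes the coefficients at earlier times
so that they are strongly continuous on ℝ. -/
theorem isVariationalSolution_iff {p : Ω × LipW n r} {v : HistC n r}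
    {z : ℝ → EuclideanSpace ℝ (Fin n)} : S.IsVariationalSolution p v z ↔
      IsDelaySolution (fun t => S.L (S.semiflow (max t 0) p)) v z := by
  constructor
  · exact fun h => ⟨h.init, h.cont, fun t ht => by
      simpa only [max_eq_left ht] using h.deriv t ht⟩
  · exact fun h => ⟨h.init, h.cont, fun t ht => by
      simpa only [max_eq_left ht] using h.deriv t ht⟩

end DelaySystem

/-- The inclusion `W^{1,∞} → C` as a bounded operator. -/
noncomputable def LipW.toCL (n : ℕ) (r : ℝ) : LipW n r →L[ℝ] HistC n r :=
  LipW.toC.mkContinuous 1 fun f => by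
    rw [one_mul]
    exact le_max_left _ _

/-! ### Solution operators of the variational equation. -/

theorem mainTheorem8 {Ω : Type*} [MetricSpace Ω] [CompactSpace Ω] {n : ℕ} {r : ℝ} (hr : 0 < r)
    (S : DelaySystem Ω n r) (hF : S.FieldRegular) (hτ : S.DelayRegular)
    (K : Set (Ω × LipW n r)) (hK : IsCompact K) (hKinv : S.PositivelyInvariant K)
    (hKback : ∀ p ∈ K, S.HasBackwardExtension K p)
    (p : Ω × LipW n r) (hp : p ∈ K) (T : ℝ) (hT : r ≤ T) :
    -- the variational equation has exactly one solution for every initial datum in `C`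
    (∀ v : HistC n r, ∃ z, S.IsVariationalSolution p v z ∧
      ∀ z', S.IsVariationalSolution p v z' → Set.EqOn z' z (Set.Ici (-r))) ∧
    -- the operator from `C` to `W^{1,∞}` is well defined, linear and continuous
    (∀ v : HistC n r, (S.piTilde T p v).IsLip ∧ (S.piHat T p v).toC = S.piTilde T p v) ∧
    IsLinearMap ℝ (S.piHat T p) ∧
    Continuous (S.piHat T p) ∧
    -- and it is compact for `T ≥ 2r`, as is the operator on `W^{1,∞}`
    (2 * r ≤ T → IsCompactOperator (S.piHat T p)) ∧
    (2 * r ≤ T →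
      (∀ v : LipW n r, (S.piL T p v).toC = S.piTilde T p v.toC) ∧
      IsLinearMap ℝ (S.piL T p) ∧
      IsCompactOperator (S.piL T p)) := by
  have hA := DelaySystem.continuous_L_semiflow hr hF hτ hKinv hp (hKback p hp)
  obtain ⟨U, hU⟩ := exists_solutionOperator hr.le hA hT
  have hex : ∀ v, ∃ z, S.IsVariationalSolution p v z := fun v =>
    (exists_isDelaySolution hr.le hA v).imp fun z hz => DelaySystem.isVariationalSolution_iff.2 hz
  have hsol : ∀ v, S.IsVariationalSolution p v (S.varSol p v) := fun v => by
    have h : S.varSol p v = (hex v).choose := dif_pos (hex v)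
    rw [h]
    exact (hex v).choose_spec
  have hUt : ∀ v, (U v).toC = S.piTilde T p v := fun v =>
    hU v _ (DelaySystem.isVariationalSolution_iff.1 (hsol v))
  have hlip : ∀ v, (S.piTilde T p v).IsLip := fun v => hUt v ▸ (U v).isLip
  have hhat : S.piHat T p = U := funext fun v => LipW.toC_injective
    ((LipW.toC_ofC (hlip v)).trans (hUt v).symm)
  -- A compact operator on C restricted along the bounded inclusion W^{1,∞} → C remains compact.
  have hL : S.piL T p = U ∘ LipW.toCL n r := funext fun v => congrFun hhat v.toC
  refine ⟨fun v => ⟨_, hsol v, fun z' hz' => ?_⟩, fun v => ⟨hlip v, LipW.toC_ofC (hlip v)⟩, ?_, ?_,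
    fun hT2 => ?_, fun hT2 => ⟨fun v => LipW.toC_ofC (hlip v.toC), ?_, ?_⟩⟩
  · exact (DelaySystem.isVariationalSolution_iff.1 hz').unique hr.le hA
      (DelaySystem.isVariationalSolution_iff.1 (hsol v))
  · rw [hhat]
    exact U.toLinearMap.isLinear
  · rw [hhat]
    exact U.continuous
  · rw [hhat]
    exact isCompactOperator_of_solutionOperator hr.le hA hT2 U hU
  · rw [hL]
    exact (U.comp (LipW.toCL n r)).toLinearMap.isLinear
  · rw [hL]
    exact (isCompactOperator_of_solutionOperator hr.le hA hT2 U hU).comp_clm _
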